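/- **Setting.** A nonautonomous dynamical system $(\mathbf X,\mathbf T)$ consists of compact metric spaces $(X_k,d_{X_k})$ and continuous maps $T_k:X_k\to X_{k+1}$, $k=0,1,2,\dots$. Write $\mathbf T^0=\mathrm{id}$, $\mathbf T^j=T_{j-1}\circ\dots\circ T_0:X_0\to X_j$, and for $n\ge 1$ let $d_n^{\mathbf T}(x,y)=\max_{0\le j\le n-1}d_{X_j}(\mathbf T^jx,\mathbf T^jy)$ on $X_0$, with open and closed balls $B_n^{\mathbf T}(x,\varepsilon)$, $\overline B{}_n^{\mathbf T}(x,\varepsilon)$. A potential is a sequence $\mathbf f=(f_k)_{k\ge0}$ of continuous functions $f_k:X_k\to\mathbb R$; put $S_n^{\mathbf T}\mathbf f=\sum_{j=0}^{n-1}f_j\circ\mathbf T^j$. It is equicontinuous if for every $\varepsilon>0$ there is $\delta>0$ such that $|f_k(x')-f_k(x'')|<\varepsilon$ for all $k\ge 0$ and all $x',x''\in X_k$ with $d_{X_k}(x',x'')<\delta$. **Bowen pressure.** For $Z\subset X_0$, $s\in\mathbb R$, $\varepsilon>0$, $N\ge1$ let $$\mathscr M^s_{N,\varepsilon}(\mathbf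 T,\mathbf f,Z)=\inf\sum_i\exp\bigl(-n_is+S_{n_i}^{\mathbf T}\mathbf f(x_i)\bigr),$$ the infimum over all countable (possibly finite or empty) families $\{B_{n_i}^{\mathbf T}(x_i,\varepsilon)\}_i$ with $x_i\in X_0$ and $n_i\ge N$ that cover $Z$. Let $\mathscr M^s_\varepsilon=\lim_{N\to\infty}\mathscr M^s_{N,\varepsilon}$ and $$P^B(\mathbf T,\mathbf f,Z)=\lim_{\varepsilon\to0}\ \inf\{s\in\mathbb R:\mathscr M^s_\varepsilon(\mathbf T,\mathbf f,Z)=0\}\in[-\infty,\infty].$$ **Packing pressure.** Let $$\mathscr P^s_{N,\varepsilon}(\mathbf T,\mathbf f,Z)=\sup\sum_i\exp\bigl(-n_is+S_{n_i}^{\mathbf T}\mathbf f(x_i)\bigr),$$ the supremum over all countable (possibly finite or empty) families of pairwise disjoint closed balls $\overline B{}_{n_i}^{\mathbf T}(x_i,\varepsilon)$ with $x_i\in Z$ and $n_i\ge N$. Let $\mathscr P^s_{\infty,\varepsilon}=\lim_{N\to\infty}\mathscr P^s_{N,\varepsilon}$, let $\mathscr P^s_\varepsilon(\mathbf T,\mathbf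 f,Z)=\inf\{\sum_{i=1}^\infty\mathscr P^s_{\infty,\varepsilon}(\mathbf T,\mathbf f,Z_i):Z_i\subset X_0,\ \bigcup_iZ_i\supset Z\}$, and $$P^P(\mathbf T,\mathbf f,Z)=\lim_{\varepsilon\to0}\ \inf\{s\in\mathbb R:\mathscr P^s_\varepsilon(\mathbf T,\mathbf f,Z)=0\}\in[-\infty,\infty].$$ **Theorem.** Let $(\mathbf X,\mathbf T)$ and $(\mathbf Y,\mathbf R)$ be nonautonomous dynamical systems, and let $\mathbf f$ on $\mathbf X$ and $\mathbf g$ on $\mathbf Y$ be equicontinuous potentials. Give $X_k\times Y_k$ the maximum metric, let $(T_k\times R_k)(x,y)=(T_kx,R_ky)$, and let $(f_k\dotplus g_k)(x,y)=f_k(x)+g_k(y)$. Then for all $Z\subset X_0$ and $W\subset Y_0$, $$P^B(\mathbf T,\mathbf f,Z)+P^B(\mathbf R,\mathbf g,W)\ \le\ P^B(\mathbf T\times\mathbf R,\mathbf f\dotplus\mathbf g,Z\times W)\ \le\ P^B(\mathbf T,\mathbf f,Z)+P^P(\mathbf R,\mathbf g,W),$$ where each of the two inequalities is asserted whenever the sum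 that occurs in it is not of the form $\infty-\infty$. -/

import Mathlib

open Filter Topology
open scoped ENNReal

namespace NDS

noncomputable section

universe u v

/-! A nonautonomous dynamical system is given by a sequence `X` of compact metric spaces and a
sequence of continuous maps `T k : X k → X (k + 1)`; a potential is a sequence of continuous
functions `f k : X k → ℝ`. -/

/-- The iterate `T^j = T_{j-1} ∘ ⋯ ∘ T_0 : X 0 → X j`. -/
def orbit {X : ℕ → Type u} [∀ k, MetricSpace (X k)] (T : ∀ k, C(X k, X (k + 1))) :
    ∀ j : ℕ, X 0 → X j
  | 0, x => x
  | j + 1, x => T j (orbit T j x)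

/-- The `n`-th Bowen metric `max_{0 ≤ j ≤ n-1} d_j (T^j x, T^j y)` on `X 0`
(with value `0` for `n = 0`). -/
def bowenDist {X : ℕ → Type u} [∀ k, MetricSpace (X k)] (T : ∀ k, C(X k, X (k + 1)))
    (n : ℕ) (x y : X 0) : ℝ :=
  ((Finset.range n).sup fun j => nndist (orbit T j x) (orbit T j y) : NNReal)

/-- The open Bowen ball. -/
def bowenBall {X : ℕ → Type u} [∀ k, MetricSpace (X k)] (T : ∀ k, C(X k, X (k + 1)))
    (n : ℕ) (x : X 0) (ε : ℝ) : Set (X 0) :=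
  {y | bowenDist T n x y < ε}

/-- The closed Bowen ball. -/
def closedBowenBall {X : ℕ → Type u} [∀ k, MetricSpace (X k)] (T : ∀ k, C(X k, X (k + 1)))
    (n : ℕ) (x : X 0) (ε : ℝ) : Set (X 0) :=
  {y | bowenDist T n x y ≤ ε}

/-- The Birkhoff sum `S_n f = ∑_{j < n} f_j ∘ T^j`. -/
def birkhoff {X : ℕ → Type u} [∀ k, MetricSpace (X k)] (T : ∀ k, C(X k, X (k + 1)))
    (f : ∀ k, C(X k, ℝ)) (n : ℕ) (x : X 0) : ℝ :=
  ∑ j ∈ Finset.range n, f j (orbit T j x)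

/-- Equicontinuity of a potential, uniform in the level `k`. -/
def EquicontinuousPotential {X : ℕ → Type u} [∀ k, MetricSpace (X k)]
    (f : ∀ k, C(X k, ℝ)) : Prop :=
  ∀ ε : ℝ, 0 < ε → ∃ δ : ℝ, 0 < δ ∧
    ∀ (k : ℕ) (x' x'' : X k), dist x' x'' < δ → |f k x' - f k x''| < ε

/-- The weight `exp (-n s + S_n f (x))` of the Bowen ball with centre `p.1 = x` and
length `p.2 = n`. -/
def weight {X : ℕ → Type u} [∀ k, MetricSpace (X k)] (T : ∀ k, C(X k, X (k + 1)))
    (f : ∀ k, C(X k, ℝ)) (s : ℝ) (p : X 0 × ℕ) : ℝ≥0∞ :=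
  ENNReal.ofReal (Real.exp (-(p.2 : ℝ) * s + birkhoff T f p.2 p.1))

/-- A countable (finite, empty or infinite) `(N, ε)`-cover of `Z` by open Bowen balls, encoded by
the set of the pairs `(x_i, n_i)`. -/
def IsCover {X : ℕ → Type u} [∀ k, MetricSpace (X k)] (T : ∀ k, C(X k, X (k + 1)))
    (Z : Set (X 0)) (N : ℕ) (ε : ℝ) (C : Set (X 0 × ℕ)) : Prop :=
  C.Countable ∧ (∀ p ∈ C, N ≤ p.2) ∧ Z ⊆ ⋃ p ∈ C, bowenBall T p.2 p.1 ε

/-- The Bowen premeasure: the infimum of `∑ exp (-n_i s + S_{n_i} f (x_i))` over countable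
`(N, ε)`-covers of `Z`. -/
def bowenMeasN {X : ℕ → Type u} [∀ k, MetricSpace (X k)] (T : ∀ k, C(X k, X (k + 1)))
    (f : ∀ k, C(X k, ℝ)) (Z : Set (X 0)) (s : ℝ) (ε : ℝ) (N : ℕ) : ℝ≥0∞ :=
  ⨅ (C : Set (X 0 × ℕ)) (_ : IsCover T Z N ε C), ∑' p : C, weight T f s p

/-- The limit of `bowenMeasN` as `N → ∞`, which is a supremum since `bowenMeasN` increases with
`N` (see `tendsto_bowenMeasN`). -/
def bowenMeas {X : ℕ → Type u} [∀ k, MetricSpace (X k)] (T : ∀ k, C(X k, X (k + 1)))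
    (f : ∀ k, C(X k, ℝ)) (Z : Set (X 0)) (ε s : ℝ) : ℝ≥0∞ :=
  ⨆ N : ℕ, bowenMeasN T f Z s ε N

/-- The critical value `inf {s | bowenMeas s = 0}` in `[-∞, ∞]`
(see `bowenPressureAt_eq_iSup` for the description as a supremum). -/
def bowenPressureAt {X : ℕ → Type u} [∀ k, MetricSpace (X k)] (T : ∀ k, C(X k, X (k + 1)))
    (f : ∀ k, C(X k, ℝ)) (Z : Set (X 0)) (ε : ℝ) : EReal :=
  ⨅ (s : ℝ) (_ : bowenMeas T f Z ε s = 0), (s : EReal)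

/-- The Bowen pressure of `T` for `f` on `Z`: the limit of `bowenPressureAt` as `ε → 0`, which is
a supremum by monotonicity (see `tendsto_bowenPressureAt`). -/
def bowenPressure {X : ℕ → Type u} [∀ k, MetricSpace (X k)] (T : ∀ k, C(X k, X (k + 1)))
    (f : ∀ k, C(X k, ℝ)) (Z : Set (X 0)) : EReal :=
  ⨆ (ε : ℝ) (_ : 0 < ε), bowenPressureAt T f Z ε

/-- A countable (finite, empty or infinite) `(N, ε)`-packing of `Z` by pairwise disjoint closed
Bowen balls with centres in `Z`, encoded by the set of the pairs `(x_i, n_i)`. -/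
def IsPacking {X : ℕ → Type u} [∀ k, MetricSpace (X k)] (T : ∀ k, C(X k, X (k + 1)))
    (Z : Set (X 0)) (N : ℕ) (ε : ℝ) (C : Set (X 0 × ℕ)) : Prop :=
  C.Countable ∧ (∀ p ∈ C, p.1 ∈ Z ∧ N ≤ p.2) ∧
    C.PairwiseDisjoint fun p => closedBowenBall T p.2 p.1 ε

/-- The supremum of `∑ exp (-n_i s + S_{n_i} f (x_i))` over countable `(N, ε)`-packings of `Z`. -/
def packMeasN {X : ℕ → Type u} [∀ k, MetricSpace (X k)] (T : ∀ k, C(X k, X (k + 1)))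
    (f : ∀ k, C(X k, ℝ)) (Z : Set (X 0)) (s : ℝ) (ε : ℝ) (N : ℕ) : ℝ≥0∞ :=
  ⨆ (C : Set (X 0 × ℕ)) (_ : IsPacking T Z N ε C), ∑' p : C, weight T f s p

/-- The limit of `packMeasN` as `N → ∞`, which is an infimum since `packMeasN` decreases with
`N` (see `tendsto_packMeasN`). -/
def packMeasInf {X : ℕ → Type u} [∀ k, MetricSpace (X k)] (T : ∀ k, C(X k, X (k + 1)))
    (f : ∀ k, C(X k, ℝ)) (Z : Set (X 0)) (s : ℝ) (ε : ℝ) : ℝ≥0∞ :=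
  ⨅ N : ℕ, packMeasN T f Z s ε N

/-- The packing measure: the infimum of `∑ packMeasInf (Z_i)` over the countable families of
subsets `Z_i` of `X 0` that cover `Z`. -/
def packMeas {X : ℕ → Type u} [∀ k, MetricSpace (X k)] (T : ∀ k, C(X k, X (k + 1)))
    (f : ∀ k, C(X k, ℝ)) (Z : Set (X 0)) (ε s : ℝ) : ℝ≥0∞ :=
  ⨅ (A : ℕ → Set (X 0)) (_ : Z ⊆ ⋃ i, A i), ∑' i, packMeasInf T f (A i) s ε

/-- The critical value `inf {s | packMeas s = 0}` in `[-∞, ∞]`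
(see `packPressureAt_eq_iSup` for the description as a supremum). -/
def packPressureAt {X : ℕ → Type u} [∀ k, MetricSpace (X k)] (T : ∀ k, C(X k, X (k + 1)))
    (f : ∀ k, C(X k, ℝ)) (Z : Set (X 0)) (ε : ℝ) : EReal :=
  ⨅ (s : ℝ) (_ : packMeas T f Z ε s = 0), (s : EReal)

/-- The packing pressure of `T` for `f` on `Z`: the limit of `packPressureAt` as `ε → 0`, which is
a supremum by monotonicity (see `tendsto_packPressureAt`). -/
def packPressure {X : ℕ → Type u} [∀ k, MetricSpace (X k)] (T : ∀ k, C(X k, X (k + 1)))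
    (f : ∀ k, C(X k, ℝ)) (Z : Set (X 0)) : EReal :=
  ⨆ (ε : ℝ) (_ : 0 < ε), packPressureAt T f Z ε

/-- The product maps `T k × R k`. The space `X k × Y k` carries the maximum metric, which is
Mathlib's metric on a product. -/
def prodSystem {X : ℕ → Type u} {Y : ℕ → Type v} [∀ k, MetricSpace (X k)]
    [∀ k, MetricSpace (Y k)] (T : ∀ k, C(X k, X (k + 1))) (R : ∀ k, C(Y k, Y (k + 1))) :
    ∀ k, C(X k × Y k, X (k + 1) × Y (k + 1)) :=
  fun k => (T k).prodMap (R k)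

/-- The potential `(x, y) ↦ f k x + g k y` on the product. -/
def prodPotential {X : ℕ → Type u} {Y : ℕ → Type v} [∀ k, MetricSpace (X k)]
    [∀ k, MetricSpace (Y k)] (f : ∀ k, C(X k, ℝ)) (g : ∀ k, C(Y k, ℝ)) :
    ∀ k, C(X k × Y k, ℝ) :=
  fun k => (f k).comp ContinuousMap.fst + (g k).comp ContinuousMap.snd

/-- The sum of two extended reals is not of the form `∞ - ∞`. -/
def SumDefined (a b : EReal) : Prop :=
  ¬ (a = ⊤ ∧ b = ⊥) ∧ ¬ (a = ⊥ ∧ b = ⊤)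

/-! The limits and critical values above are the intended ones. -/

section Facts

variable {X : ℕ → Type u} [∀ k, MetricSpace (X k)] (T : ∀ k, C(X k, X (k + 1)))
  (f : ∀ k, C(X k, ℝ)) (Z : Set (X 0))

theorem bowenMeasN_mono (s ε : ℝ) : Monotone (bowenMeasN T f Z s ε) := fun _ _ h =>
  le_iInf₂ fun C hC => iInf₂_le C ⟨hC.1, fun p hp => h.trans (hC.2.1 p hp), hC.2.2⟩

theorem tendsto_bowenMeasN (s ε : ℝ) :
    Tendsto (bowenMeasN T f Z s ε) atTop (𝓝 (bowenMeas T f Z ε s)) :=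
  tendsto_atTop_iSup (bowenMeasN_mono T f Z s ε)

theorem packMeasN_anti (s ε : ℝ) : Antitone (packMeasN T f Z s ε) := fun _ _ h =>
  iSup₂_le fun C hC => le_iSup₂_of_le C
    ⟨hC.1, fun p hp => ⟨(hC.2.1 p hp).1, h.trans (hC.2.1 p hp).2⟩, hC.2.2⟩ le_rfl

theorem tendsto_packMeasN (s ε : ℝ) :
    Tendsto (packMeasN T f Z s ε) atTop (𝓝 (packMeasInf T f Z s ε)) :=
  tendsto_atTop_iInf (packMeasN_anti T f Z s ε)

theorem bowenMeas_anti_radius (s : ℝ) : Antitone fun ε => bowenMeas T f Z ε s := fun _ _ h =>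
  iSup_mono fun _ => le_iInf₂ fun C hC => iInf₂_le C ⟨hC.1, hC.2.1, hC.2.2.trans <|
    Set.iUnion₂_mono fun _ _ _ hy => lt_of_lt_of_le hy h⟩

theorem packMeas_anti_radius (s : ℝ) : Antitone fun ε => packMeas T f Z ε s := fun _ _ h =>
  iInf₂_mono fun _ _ => ENNReal.tsum_le_tsum fun _ => iInf_mono fun _ =>
    iSup₂_le fun C hC => le_iSup₂_of_le C ⟨hC.1, hC.2.1, fun _ hp _ hq hpq =>
      (hC.2.2 hp hq hpq).mono (fun _ hy => le_trans hy h) (fun _ hy => le_trans hy h)⟩ le_rfl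

theorem tendsto_iSup_of_antitone {F : ℝ → EReal} (hF : Antitone F) :
    Tendsto F (𝓝[>] 0) (𝓝 (⨆ (ε : ℝ) (_ : 0 < ε), F ε)) := by
  refine tendsto_order.2 ⟨fun a ha => ?_, fun a ha => ?_⟩
  · obtain ⟨δ, h⟩ := lt_iSup_iff.1 ha
    obtain ⟨hδ, h⟩ := lt_iSup_iff.1 h
    filter_upwards [Ioo_mem_nhdsGT hδ] with ε hε using h.trans_le (hF hε.2.le)
  · filter_upwards [self_mem_nhdsWithin] with ε hε
    exact (le_iSup₂ (f := fun (ε : ℝ) (_ : 0 < ε) => F ε) ε hε).trans_lt ha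

theorem tendsto_bowenPressureAt :
    Tendsto (bowenPressureAt T f Z) (𝓝[>] 0) (𝓝 (bowenPressure T f Z)) :=
  tendsto_iSup_of_antitone fun _ _ h => le_iInf₂ fun s hs =>
    iInf₂_le (f := fun (s : ℝ) (_ : bowenMeas T f Z _ s = 0) => (s : EReal)) s
      (le_antisymm ((bowenMeas_anti_radius T f Z s h).trans hs.le) bot_le)

theorem tendsto_packPressureAt :
    Tendsto (packPressureAt T f Z) (𝓝[>] 0) (𝓝 (packPressure T f Z)) :=
  tendsto_iSup_of_antitone fun _ _ h => le_iInf₂ fun s hs =>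
    iInf₂_le (f := fun (s : ℝ) (_ : packMeas T f Z _ s = 0) => (s : EReal)) s
      (le_antisymm ((packMeas_anti_radius T f Z s h).trans hs.le) bot_le)

theorem weight_le {s t : ℝ} (h : s ≤ t) {N : ℕ} {p : X 0 × ℕ} (hp : N ≤ p.2) :
    weight T f t p ≤ ENNReal.ofReal (Real.exp (-(t - s)) ^ N) * weight T f s p := by
  rw [weight, weight, ← ENNReal.ofReal_mul (by positivity), ← Real.exp_nat_mul, ← Real.exp_add]
  refine ENNReal.ofReal_le_ofReal (Real.exp_le_exp.2 ?_)
  have : (N : ℝ) * (t - s) ≤ p.2 * (t - s) :=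
    mul_le_mul_of_nonneg_right (by exact_mod_cast hp) (sub_nonneg.2 h)
  linarith

theorem tendsto_factor {s t : ℝ} (h : s < t) :
    Tendsto (fun N : ℕ => ENNReal.ofReal (Real.exp (-(t - s)) ^ N)) atTop (𝓝 0) := by
  rw [← ENNReal.ofReal_zero]
  exact ENNReal.tendsto_ofReal (tendsto_pow_atTop_nhds_zero_of_lt_one (Real.exp_pos _).le
    (Real.exp_lt_one_iff.2 (by linarith)))

theorem bowenMeas_eq_zero {s t ε : ℝ} (h : s < t) (hs : bowenMeas T f Z ε s ≠ ⊤) :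
    bowenMeas T f Z ε t = 0 := by
  have key : ∀ N, bowenMeasN T f Z t ε N ≤
      ENNReal.ofReal (Real.exp (-(t - s)) ^ N) * bowenMeas T f Z ε s := fun N => by
    have : bowenMeasN T f Z t ε N ≤
        ENNReal.ofReal (Real.exp (-(t - s)) ^ N) * bowenMeasN T f Z s ε N := by
      rw [bowenMeasN, bowenMeasN, ENNReal.mul_iInf_of_ne
        (by simpa using by positivity) ENNReal.ofReal_ne_top]
      refine le_iInf fun C => ?_
      rw [ENNReal.mul_iInf_of_ne (by simpa using by positivity) ENNReal.ofReal_ne_top]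
      refine le_iInf fun hC => (iInf₂_le C hC).trans ?_
      rw [← ENNReal.tsum_mul_left]
      exact ENNReal.tsum_le_tsum fun p => weight_le T f h.le (hC.2.1 p p.2)
    exact this.trans (mul_le_mul_right (le_iSup (bowenMeasN T f Z s ε) N) _)
  have lim := ENNReal.Tendsto.mul_const (tendsto_factor h) (Or.inr hs)
  rw [zero_mul] at lim
  exact le_antisymm (le_of_tendsto_of_tendsto' (tendsto_bowenMeasN T f Z t ε) lim key) bot_le

theorem packMeasInf_eq_zero {s t ε : ℝ} (h : s < t) (hs : packMeasInf T f Z s ε ≠ ⊤) :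
    packMeasInf T f Z t ε = 0 := by
  have key : ∀ N, packMeasN T f Z t ε N ≤
      ENNReal.ofReal (Real.exp (-(t - s)) ^ N) * packMeasN T f Z s ε N := fun N =>
    iSup₂_le fun C hC => by
      refine (ENNReal.tsum_le_tsum fun p : C => weight_le T f h.le (hC.2.1 p p.2).2).trans ?_
      rw [ENNReal.tsum_mul_left]
      exact mul_le_mul_right (le_iSup₂ (f := fun (C : Set (X 0 × ℕ))
        (_ : IsPacking T Z N ε C) => ∑' p : C, weight T f s p) C hC) _
  have lim := ENNReal.Tendsto.mul (tendsto_factor h) (Or.inr hs)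
    (tendsto_packMeasN T f Z s ε) (Or.inr ENNReal.zero_ne_top)
  rw [zero_mul] at lim
  exact le_antisymm (le_of_tendsto_of_tendsto' (tendsto_packMeasN T f Z t ε) lim key) bot_le

theorem packMeas_eq_zero {s t ε : ℝ} (h : s < t) (hs : packMeas T f Z ε s ≠ ⊤) :
    packMeas T f Z ε t = 0 := by
  obtain ⟨A, hA⟩ := iInf_lt_iff.1 (lt_top_iff_ne_top.2 hs)
  obtain ⟨hA, hA'⟩ := iInf_lt_iff.1 hA
  refine le_antisymm ((iInf₂_le A hA).trans ?_) bot_le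
  rw [ENNReal.tsum_eq_zero.2]
  exact fun i => packMeasInf_eq_zero T f (A i) h (ENNReal.ne_top_of_tsum_ne_top hA'.ne i)

theorem iInf_eq_iSup_of_jump {M : ℝ → ℝ≥0∞} (hM : ∀ s t, s < t → M s ≠ ⊤ → M t = 0) :
    (⨅ (s : ℝ) (_ : M s = 0), (s : EReal)) = ⨆ (s : ℝ) (_ : M s = ⊤), (s : EReal) := by
  refine le_antisymm (EReal.le_of_forall_lt_iff_le.1 fun t ht => ?_)
    (iSup₂_le fun s hs => le_iInf₂ fun t ht => ?_)
  · refine le_of_forall_gt_imp_ge_of_dense fun r hr => ?_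
    induction r with
    | bot => simp at hr
    | top => exact le_top
    | coe r =>
      refine iInf₂_le r (hM t r (by exact_mod_cast hr) fun h => ?_)
      exact absurd ht (not_lt.2 (le_iSup₂ (f := fun (s : ℝ) (_ : M s = ⊤) => (s : EReal)) t h))
  · by_contra hts
    have := hM t s (by exact_mod_cast not_le.1 hts) (by simp [ht])
    simp [this] at hs

theorem bowenPressureAt_eq_iSup (ε : ℝ) :
    bowenPressureAt T f Z ε = ⨆ (s : ℝ) (_ : bowenMeas T f Z ε s = ⊤), (s : EReal) :=
  iInf_eq_iSup_of_jump fun _ _ h hs => bowenMeas_eq_zero T f Z h hs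

theorem packPressureAt_eq_iSup (ε : ℝ) :
    packPressureAt T f Z ε = ⨆ (s : ℝ) (_ : packMeas T f Z ε s = ⊤), (s : EReal) :=
  iInf_eq_iSup_of_jump fun _ _ h hs => packMeas_eq_zero T f Z h hs

end Facts

end

end NDS

/-!
Both inequalities compare premeasures for one fixed minimal length `N`. They rest on the fact that
an `n`-th Bowen ball of the product system is the product of two `n`-th Bowen balls, with
multiplicative weights. A maximality argument then replaces a set by centres of balls of *one*
length `n`, that is, of one radius in one metric, so that no covering theorem is needed.

For the upper bound, let `A` be a set whose packing premeasure is at most `K`. For every `n ≥ N`, a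
maximal packing of `A` by closed balls of length `n` and radius `ε` gives a cover of `A` by balls
of radius `3 ε` whose weights add up to at most `K` (`exists_cover_of_packMeasN`). In a cover of
`Z`, every ball of length `n` is multiplied by the cover of `A` for this `n`; so the premeasure of
`Z ×ˢ A` is at most `K` times that of `Z` (`bowenMeasN_prod_le`). The packing pressure provides
countably many such sets `A` that cover `W`.

For the lower bound, the sets need not be measurable, so mass distributions are not available and
weighted covers take their place. Given a cover of `Z ×ˢ W` and `z ∈ Z`, the balls whose first
factor contains `z` have second factors that cover `W`. With the weights of the second factors as
coefficients, the first factors therefore cover each point of `Z` with total weight at least `m`,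
for any `m` below the premeasure of `W` (`mul_bowenMeasN_le_prod`). Every point of `Z` gets more
than the fraction `exp (-η n)` of `m` from the balls of some length `n`, as these fractions have
sum less than `1` over `n ≥ N`, for `N` large. For one length, a maximal `2 ε`-separated set of such
points selects an honest cover by balls of radius `2 ε` (`exists_cover_of_lt_tsum`). The cost is a
shift of the parameter by `2 η`, one `η` for the fractions and one for the distortion of the
Birkhoff sums, and it vanishes as `ε → 0` by equicontinuity.
-/

namespace NDS

variable {X Y : ℕ → Type*} [∀ k, MetricSpace (X k)] [∀ k, MetricSpace (Y k)]
  (T : ∀ k, C(X k, X (k + 1))) (R : ∀ k, C(Y k, Y (k + 1)))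
  (f : ∀ k, C(X k, ℝ)) (g : ∀ k, C(Y k, ℝ))

/-! ### Bowen balls and weights -/

theorem mem_bowenBall {n : ℕ} {x y : X 0} {ε : ℝ} (hε : 0 < ε) :
    y ∈ bowenBall T n x ε ↔ ∀ j < n, dist (orbit T j x) (orbit T j y) < ε := by
  lift ε to NNReal using hε.le
  simp only [bowenBall, bowenDist, Set.mem_ofPred_eq, NNReal.coe_lt_coe]
  rw [Finset.sup_lt_iff (by simpa using hε)]
  simp only [Finset.mem_range, ← NNReal.coe_lt_coe, coe_nndist]

theorem mem_closedBowenBall {n : ℕ} {x y : X 0} {ε : ℝ} (hε : 0 ≤ ε) :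
    y ∈ closedBowenBall T n x ε ↔ ∀ j < n, dist (orbit T j x) (orbit T j y) ≤ ε := by
  lift ε to NNReal using hε
  simp only [closedBowenBall, bowenDist, Set.mem_ofPred_eq, NNReal.coe_le_coe, Finset.sup_le_iff]
  simp only [Finset.mem_range, ← NNReal.coe_le_coe, coe_nndist]

theorem bowenBall_mono (n : ℕ) (x : X 0) {ε ε' : ℝ} (h : ε ≤ ε') :
    bowenBall T n x ε ⊆ bowenBall T n x ε' := fun _ hy => lt_of_lt_of_le hy h

theorem orbit_prod (j : ℕ) (q : X 0 × Y 0) :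
    orbit (X := fun k => X k × Y k) (prodSystem T R) j q = (orbit T j q.1, orbit R j q.2) := by
  induction j with
  | zero => rfl
  | succ j ih => simp only [orbit, ih]; rfl

theorem mem_bowenBall_prod {n : ℕ} {p q : X 0 × Y 0} {ε : ℝ} (hε : 0 < ε) :
    q ∈ bowenBall (X := fun k => X k × Y k) (prodSystem T R) n p ε ↔
      q.1 ∈ bowenBall T n p.1 ε ∧ q.2 ∈ bowenBall R n p.2 ε := by
  rw [mem_bowenBall T hε, mem_bowenBall R hε,
    mem_bowenBall (X := fun k => X k × Y k) (prodSystem T R) hε]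
  simp only [orbit_prod, Prod.dist_eq, max_lt_iff, forall_and]

theorem birkhoff_prod (n : ℕ) (q : X 0 × Y 0) :
    birkhoff (X := fun k => X k × Y k) (prodSystem T R) (prodPotential f g) n q =
      birkhoff T f n q.1 + birkhoff R g n q.2 := by
  simp only [birkhoff, orbit_prod, ← Finset.sum_add_distrib]
  rfl

theorem weight_prod (s t : ℝ) (q : X 0 × Y 0) (n : ℕ) :
    weight (X := fun k => X k × Y k) (prodSystem T R) (prodPotential f g) (s + t) (q, n) =
      weight T f s (q.1, n) * weight R g t (q.2, n) := by
  rw [weight, weight, weight, ← ENNReal.ofReal_mul (Real.exp_pos _).le, ← Real.exp_add,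
    birkhoff_prod]
  congr 2
  ring

theorem weight_ne_zero (s : ℝ) (p : X 0 × ℕ) : weight T f s p ≠ 0 := by
  simpa [weight] using Real.exp_pos _

variable {T f} in
/-- Equicontinuity makes the distortion of Birkhoff sums on Bowen balls at most linear in the
length, which is absorbed by a shift of the parameter. -/
theorem weight_add_le {γ ε : ℝ} (hε : 0 < ε)
    (hγ : ∀ (k : ℕ) (x' x'' : X k), dist x' x'' < ε → |f k x' - f k x''| < γ) (s : ℝ) {n : ℕ}
    {x y : X 0} (hy : y ∈ bowenBall T n x ε) :
    weight T f (s + γ) (y, n) ≤ weight T f s (x, n) := by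
  rw [mem_bowenBall T hε] at hy
  refine ENNReal.ofReal_le_ofReal (Real.exp_le_exp.2 ?_)
  have : birkhoff T f n y ≤ birkhoff T f n x + n * γ := by
    calc birkhoff T f n y ≤ ∑ j ∈ Finset.range n, (f j (orbit T j x) + γ) :=
          Finset.sum_le_sum fun j hj => by
            linarith [(abs_lt.1 (hγ j _ _ (hy j (Finset.mem_range.1 hj)))).1]
      _ = _ := by simp [birkhoff, Finset.sum_add_distrib]
  simp only
  linarith

/-- A cover by Bowen balls that is indexed by an arbitrary type bounds `bowenMeasN`: either its
sum is infinite, or the index type is countable. -/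
theorem bowenMeasN_le {ι : Type*} {Z : Set (X 0)} {s ε : ℝ} {N : ℕ} (p : ι → X 0 × ℕ)
    (hN : ∀ i, N ≤ (p i).2) (hZ : ∀ z ∈ Z, ∃ i, z ∈ bowenBall T (p i).2 (p i).1 ε) :
    bowenMeasN T f Z s ε N ≤ ∑' i, weight T f s (p i) := by
  by_cases h : ∑' i, weight T f s (p i) = ⊤
  · simp [h]
  have hc : Countable ι := by
    have := Summable.countable_support_ennreal h
    rw [Function.support_eq_univ (weight_ne_zero T f s <| p ·)] at this
    exact Set.countable_univ_iff.1 this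
  refine (iInf₂_le (Set.range p) ⟨Set.countable_range p, by simpa using hN, ?_⟩).trans ?_
  · exact ENNReal.tsum_le_tsum_comp_of_surjective Set.rangeFactorization_surjective
      fun q : Set.range p => weight T f s q
  · intro z hz
    obtain ⟨i, hi⟩ := hZ z hz
    exact Set.mem_biUnion (Set.mem_range_self i) hi

theorem bowenMeasN_iUnion_eq_zero {A : ℕ → Set (X 0)} {s ε : ℝ} {N : ℕ}
    (h : ∀ i, bowenMeasN T f (A i) s ε N = 0) : bowenMeasN T f (⋃ i, A i) s ε N = 0 := by
  refine le_antisymm (le_of_forall_gt fun η hη => ?_) bot_le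
  obtain ⟨δ, hδ, hδη⟩ := ENNReal.exists_pos_sum_of_countable' hη.ne' ℕ
  have : ∀ i, ∃ C, IsCover T (A i) N ε C ∧ ∑' p : C, weight T f s p < δ i := fun i => by
    obtain ⟨C, hC⟩ := iInf_lt_iff.1 ((h i).trans_lt (hδ i))
    obtain ⟨hC, hC'⟩ := iInf_lt_iff.1 hC
    exact ⟨C, hC, hC'⟩
  choose C hC hCδ using this
  refine lt_of_le_of_lt ?_ hδη
  refine (bowenMeasN_le T f (fun q : Σ i, C i => (q.2 : X 0 × ℕ)) (fun q => (hC q.1).2.1 _ q.2.2)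
    fun z hz => ?_).trans ?_
  · obtain ⟨i, hi⟩ := Set.mem_iUnion.1 hz
    obtain ⟨p, hp, hz⟩ := Set.mem_iUnion₂.1 ((hC i).2.2 hi)
    exact ⟨⟨i, p, hp⟩, hz⟩
  · rw [ENNReal.tsum_sigma']
    exact ENNReal.tsum_le_tsum fun i => (hCδ i).le

theorem bowenMeasN_mono_set {Z Z' : Set (X 0)} (h : Z ⊆ Z') (s ε : ℝ) (N : ℕ) :
    bowenMeasN T f Z s ε N ≤ bowenMeasN T f Z' s ε N :=
  le_iInf₂ fun C hC => iInf₂_le C ⟨hC.1, hC.2.1, h.trans hC.2.2⟩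

/-- Existence of a maximal `r`-separated subset. The relation is only used at distinct points, hence
the alternative `a ∈ F`. -/
theorem exists_maximal_pairwise {α : Type*} {r : α → α → Prop} (hr : ∀ a b, r a b → r b a)
    (A : Set α) : ∃ F ⊆ A, F.Pairwise r ∧ ∀ a ∈ A, a ∈ F ∨ ∃ b ∈ F, ¬ r b a := by
  obtain ⟨F, ⟨hFA, hF⟩, hmax⟩ := zorn_subset {F | F ⊆ A ∧ F.Pairwise r} fun c hc hchain =>
    ⟨⋃₀ c, ⟨Set.sUnion_subset fun s hs => (hc hs).1,
      (Set.pairwise_sUnion hchain.directedOn).2 fun s hs => (hc hs).2⟩,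
      fun s hs => Set.subset_sUnion_of_mem hs⟩
  refine ⟨F, hFA, hF, fun a ha => ?_⟩
  by_contra! h
  refine h.1 (hmax (y := insert a F) ⟨Set.insert_subset ha hFA, hF.insert fun b hb _ => ?_⟩
    (Set.subset_insert a F) (Set.mem_insert a F))
  exact ⟨hr _ _ (h.2 b hb), h.2 b hb⟩

/-! ### The upper bound -/

/-- For a fixed length `n`, the centres of a maximal packing of `A` by closed balls of radius `ε`
give a cover of `A` by open balls of radius `3 ε`. -/
theorem exists_cover_of_packMeasN {A : Set (X 0)} {s ε : ℝ} (hε : 0 < ε) {N n : ℕ} (hn : N ≤ n) :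
    ∃ F : Set (X 0), (∀ a ∈ A, ∃ y ∈ F, a ∈ bowenBall T n y (3 * ε)) ∧
      ∑' y : F, weight T f s (y, n) ≤ packMeasN T f A s ε N := by
  obtain ⟨F, hFA, hF, hcov⟩ := exists_maximal_pairwise
    (r := fun a b => Disjoint (closedBowenBall T n a ε) (closedBowenBall T n b ε))
    (fun _ _ h => h.symm) A
  refine ⟨F, fun a ha => ?_, ?_⟩
  · simp only [mem_bowenBall T (show 0 < 3 * ε by positivity)]
    rcases hcov a ha with h | ⟨b, hb, h⟩
    · exact ⟨a, h, fun j _ => by simpa using hε⟩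
    · obtain ⟨c, hbc, hac⟩ := Set.not_disjoint_iff.1 h
      rw [mem_closedBowenBall T hε.le] at hbc hac
      refine ⟨b, hb, fun j hj => ?_⟩
      linarith [dist_triangle_right (orbit T j b) (orbit T j a) (orbit T j c), hbc j hj, hac j hj]
  · -- Finite subsets of `F` suffice, and these are countable packings.
    rw [ENNReal.tsum_eq_iSup_sum]
    refine iSup_le fun G => ?_
    let e : X 0 → X 0 × ℕ := fun y => (y, n)
    have he : Function.Injective fun y : F => e y := fun y z h => Subtype.ext (congrArg Prod.fst h)
    let H : Finset (X 0 × ℕ) := G.map ⟨_, he⟩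
    have hH : ∑ y ∈ G, weight T f s (y, n) = ∑' p : (H : Set (X 0 × ℕ)), weight T f s p := by
      rw [Finset.tsum_subtype', Finset.sum_map]
      rfl
    rw [hH]
    refine le_iSup₂ (f := fun (C : Set (X 0 × ℕ)) (_ : IsPacking T A N ε C) =>
      ∑' p : C, weight T f s p) (H : Set (X 0 × ℕ)) ⟨H.countable_toSet, ?_, ?_⟩
    · intro p hp
      obtain ⟨y, -, rfl⟩ := Finset.mem_map.1 (Finset.mem_coe.1 hp)
      exact ⟨hFA y.2, hn⟩
    · intro p hp q hq hpq
      obtain ⟨y, -, rfl⟩ := Finset.mem_map.1 (Finset.mem_coe.1 hp)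
      obtain ⟨z, -, rfl⟩ := Finset.mem_map.1 (Finset.mem_coe.1 hq)
      exact hF y.2 z.2 fun h => hpq (congrArg e h)

/-- Every ball of length `n` in a cover of `Z` is multiplied by the balls of the same length `n`
that cover `A`. -/
theorem bowenMeasN_prod_le {Z : Set (X 0)} {A : Set (Y 0)} {s u ε : ℝ} (hε : 0 < ε) {N : ℕ}
    {K : ℝ≥0∞} (hK0 : K ≠ 0) (hK : K ≠ ⊤) (h : packMeasN R g A u ε N ≤ K) :
    bowenMeasN (X := fun k => X k × Y k) (prodSystem T R) (prodPotential f g) (Z ×ˢ A) (s + u)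
      (3 * ε) N ≤ bowenMeasN T f Z s ε N * K := by
  have h3 : 0 < 3 * ε := by positivity
  rw [bowenMeasN, bowenMeasN, ENNReal.iInf_mul_of_ne hK0 hK]
  refine le_iInf fun C => ?_
  rw [ENNReal.iInf_mul_of_ne hK0 hK]
  refine le_iInf fun hC => ?_
  choose F hF hFK using fun p : C =>
    exists_cover_of_packMeasN R g (A := A) (s := u) hε (hC.2.1 p p.2)
  refine (bowenMeasN_le (X := fun k => X k × Y k) (prodSystem T R) (prodPotential f g)
    (fun q : Σ p : C, F p => ((q.1.1.1, (q.2 : Y 0)), q.1.1.2))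
    (fun q => hC.2.1 _ q.1.2) ?_).trans ?_
  · rintro ⟨z, w⟩ ⟨hz, hw⟩
    obtain ⟨p, hp, hzp⟩ := Set.mem_iUnion₂.1 (hC.2.2 hz)
    obtain ⟨y, hy, hwy⟩ := hF ⟨p, hp⟩ w hw
    refine ⟨⟨⟨p, hp⟩, y, hy⟩, (mem_bowenBall_prod T R h3).2 ⟨?_, hwy⟩⟩
    exact bowenBall_mono T _ _ (by linarith) hzp
  · rw [ENNReal.tsum_sigma', ← ENNReal.tsum_mul_right]
    refine ENNReal.tsum_le_tsum fun p => ?_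
    simp only [weight_prod]
    rw [ENNReal.tsum_mul_left]
    exact mul_le_mul_right ((hFK p).trans h) _

theorem bowenMeas_prod_eq_zero {Z : Set (X 0)} {W : Set (Y 0)} {s u ε : ℝ} (hε : 0 < ε)
    (hZ : bowenMeas T f Z ε s = 0) (hW : packMeas R g W ε u = 0) :
    bowenMeas (X := fun k => X k × Y k) (prodSystem T R) (prodPotential f g) (Z ×ˢ W)
      (3 * ε) (s + u) = 0 := by
  obtain ⟨A, hA⟩ := iInf_lt_iff.1 (hW.trans_lt ENNReal.zero_lt_top)
  obtain ⟨hWA, hA⟩ := iInf_lt_iff.1 hA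
  have hZN : ∀ N, bowenMeasN T f Z s ε N = 0 := fun N =>
    ENNReal.iSup_eq_zero.1 hZ N
  refine ENNReal.iSup_eq_zero.2 fun N => ?_
  have hsub : Z ×ˢ W ⊆ ⋃ i, Z ×ˢ A i := by
    rw [← Set.prod_iUnion]
    exact Set.prod_mono_right hWA
  refine le_antisymm ((bowenMeasN_mono_set (X := fun k => X k × Y k) _ _ hsub _ _ _).trans_eq <|
    bowenMeasN_iUnion_eq_zero (X := fun k => X k × Y k) _ _ (A := fun i => Z ×ˢ A i)
      fun i => ?_) bot_le
  · obtain ⟨M, hM⟩ := iInf_lt_iff.1 (lt_top_iff_ne_top.2 (ENNReal.ne_top_of_tsum_ne_top hA.ne i))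
    have := bowenMeasN_prod_le T R f g (Z := Z) (A := A i) (s := s) (u := u) hε
      (N := max M N) (K := packMeasN R g (A i) u ε M + 1) (by simp) (by simpa using hM.ne)
      ((packMeasN_anti R g (A i) u ε (le_max_left M N)).trans le_self_add)
    rw [hZN, zero_mul] at this
    exact le_antisymm ((bowenMeasN_mono _ _ _ _ _ (le_max_right M N)).trans this) bot_le

theorem bowenMeas_eq_zero_of_bowenPressure_lt {Z : Set (X 0)} {s ε : ℝ} (hε : 0 < ε)
    (h : bowenPressure T f Z < s) : bowenMeas T f Z ε s = 0 := by
  have h' : bowenPressureAt T f Z ε < s := (le_iSup₂ (f := fun (ε : ℝ) (_ : 0 < ε) =>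
    bowenPressureAt T f Z ε) ε hε).trans_lt h
  obtain ⟨r, hr⟩ := iInf_lt_iff.1 h'
  obtain ⟨hr, hrs⟩ := iInf_lt_iff.1 hr
  exact bowenMeas_eq_zero T f Z (by exact_mod_cast hrs) (by simp [hr])

theorem packMeas_eq_zero_of_packPressure_lt {Z : Set (X 0)} {s ε : ℝ} (hε : 0 < ε)
    (h : packPressure T f Z < s) : packMeas T f Z ε s = 0 := by
  have h' : packPressureAt T f Z ε < s := (le_iSup₂ (f := fun (ε : ℝ) (_ : 0 < ε) =>
    packPressureAt T f Z ε) ε hε).trans_lt h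
  obtain ⟨r, hr⟩ := iInf_lt_iff.1 h'
  obtain ⟨hr, hrs⟩ := iInf_lt_iff.1 hr
  exact packMeas_eq_zero T f Z (by exact_mod_cast hrs) (by simp [hr])

theorem bowenPressure_prod_le (Z : Set (X 0)) (W : Set (Y 0))
    (h : SumDefined (bowenPressure T f Z) (packPressure R g W)) :
    bowenPressure (X := fun k => X k × Y k) (prodSystem T R) (prodPotential f g) (Z ×ˢ W) ≤
      bowenPressure T f Z + packPressure R g W := by
  refine EReal.le_add_of_forall_gt (not_and_or.1 h.2) (not_and_or.1 h.1) fun a ha b hb => ?_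
  induction a with
  | bot => simp at ha
  | top => simp [EReal.top_add_of_ne_bot hb.ne_bot]
  | coe s =>
    induction b with
    | bot => simp at hb
    | top => simp
    | coe u =>
      refine iSup₂_le fun ε hε => ?_
      have hε' : 0 < ε / 3 := by positivity
      have := bowenMeas_prod_eq_zero T R f g hε'
        (bowenMeas_eq_zero_of_bowenPressure_lt T f hε' ha)
        (packMeas_eq_zero_of_packPressure_lt R g hε' hb)
      rw [mul_div_cancel₀ _ (by norm_num)] at this
      rw [← EReal.coe_add]
      exact iInf₂_le (f := fun (s : ℝ) (_ : bowenMeas (X := fun k => X k × Y k) (prodSystem T R)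
        (prodPotential f g) (Z ×ˢ W) ε s = 0) => (s : EReal)) (s + u) this

/-! ### The lower bound -/

/-- Selection among weighted Bowen balls of one fixed length `n`: the points of `Z` where the total
weight of the balls exceeds `τ` are covered by balls of radius `2 ε` centred at a `2 ε`-separated
set of such points. A ball of radius `ε` contains at most one of these centres, so the sum over
them is controlled by the weighted sum. -/
theorem exists_cover_of_lt_tsum {ι : Type*} {Z : Set (X 0)} {s γ ε : ℝ} (hε : 0 < ε)
    (hγ : ∀ (k : ℕ) (x' x'' : X k), dist x' x'' < ε → |f k x' - f k x''| < γ) (n : ℕ)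
    (x : ι → X 0) (c : ι → ℝ≥0∞) (τ : ℝ≥0∞) :
    ∃ F : Set (X 0),
      (∀ z ∈ Z, τ < ∑' i, (bowenBall T n (x i) ε).indicator (fun _ => c i) z →
        ∃ y ∈ F, z ∈ bowenBall T n y (2 * ε)) ∧
      τ * ∑' y : F, weight T f (s + γ) (y, n) ≤ ∑' i, c i * weight T f s (x i, n) := by
  have h2 : 0 < 2 * ε := by positivity
  obtain ⟨F, hFA, hF, hcov⟩ := exists_maximal_pairwise
    (r := fun a b => b ∉ bowenBall T n a (2 * ε))
    (fun a b h => by simpa only [mem_bowenBall T h2, dist_comm] using h)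
    {z ∈ Z | τ < ∑' i, (bowenBall T n (x i) ε).indicator (fun _ => c i) z}
  refine ⟨F, fun z hz hτ => ?_, ?_⟩
  · rcases hcov z ⟨hz, hτ⟩ with h | ⟨b, hb, h⟩
    · exact ⟨z, h, (mem_bowenBall T h2).2 fun j _ => by simpa using hε⟩
    · exact ⟨b, hb, not_not.1 h⟩
  · calc τ * ∑' y : F, weight T f (s + γ) (y, n)
        = ∑' y : F, τ * weight T f (s + γ) (y, n) := ENNReal.tsum_mul_left.symm
      _ ≤ ∑' y : F, ∑' i, (bowenBall T n (x i) ε).indicator (fun _ => c i) (y : X 0) *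
            weight T f (s + γ) (y, n) := ENNReal.tsum_le_tsum fun y => by
          rw [ENNReal.tsum_mul_right]
          exact mul_le_mul_left (hFA y.2).2.le _
      _ = ∑' i, ∑' y : F, (bowenBall T n (x i) ε).indicator (fun _ => c i) (y : X 0) *
            weight T f (s + γ) (y, n) := ENNReal.tsum_comm
      _ ≤ ∑' i, c i * weight T f s (x i, n) := ENNReal.tsum_le_tsum fun i => ?_
    by_cases h : ∃ y : F, (y : X 0) ∈ bowenBall T n (x i) ε
    · obtain ⟨y, hy⟩ := h
      rw [tsum_eq_single y fun y' hne => ?_]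
      · rw [Set.indicator_of_mem hy]
        exact mul_le_mul_right (weight_add_le hε hγ s hy) _
      · rw [Set.indicator_of_notMem, zero_mul]
        refine fun hy' => hF y.2 y'.2 (fun h => hne (Subtype.ext h.symm)) ?_
        rw [mem_bowenBall T hε] at hy hy'
        refine (mem_bowenBall T h2).2 fun j hj => ?_
        linarith [dist_triangle_left (orbit T j (y : X 0)) (orbit T j (y' : X 0))
          (orbit T j (x i)), hy j hj, hy' j hj]
    · push Not at h
      simp [Set.indicator_of_notMem (h _)]

/-- Comparison of the Bowen premeasure with weighted covers. If the weighted Bowen balls have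
total weight at least `m` at every point of `Z`, then, the fractions `τ k` having sum less than
`1`, at every point the balls of some length `k + N` have total weight more than `m * τ k`; so the
selections for the single lengths together cover `Z`. -/
theorem mul_bowenMeasN_le_tsum {ι : Type*} {Z : Set (X 0)} {s s' γ ε : ℝ} (hε : 0 < ε)
    (hγ : ∀ (k : ℕ) (x' x'' : X k), dist x' x'' < ε → |f k x' - f k x''| < γ) {N : ℕ}
    (p : ι → X 0 × ℕ) (hN : ∀ i, N ≤ (p i).2) (c : ι → ℝ≥0∞) {m : ℝ≥0∞} (hm0 : m ≠ 0)
    (hm : m ≠ ⊤)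
    (hZ : ∀ z ∈ Z, m ≤ ∑' i, (bowenBall T (p i).2 (p i).1 ε).indicator (fun _ => c i) z)
    {τ : ℕ → ℝ≥0∞} (hτ : ∑' k, τ k < 1)
    (hs : ∀ k y, weight T f s' (y, k + N) ≤ τ k * weight T f (s + γ) (y, k + N)) :
    m * bowenMeasN T f Z s' (2 * ε) N ≤ ∑' i, c i * weight T f s (p i) := by
  -- The balls are grouped by length: the group `k` consists of those of length `k + N`.
  let φ : ι → ℕ := fun i => (p i).2 - N
  have hφ : ∀ (k : ℕ) (i : {i // φ i = k}), (p i).2 = k + N := fun k i => by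
    have h1 : (p i).2 - N = k := i.2
    have h2 := hN i
    omega
  have hsum : ∀ u : ι → ℝ≥0∞, ∑' i, u i = ∑' k, ∑' i : {i // φ i = k}, u i := fun u => by
    rw [← (Equiv.sigmaFiberEquiv φ).tsum_eq, ENNReal.tsum_sigma']
    rfl
  choose F hFcov hFsum using fun k => exists_cover_of_lt_tsum T f (Z := Z) (s := s) hε hγ (k + N)
    (fun i : {i // φ i = k} => (p i).1) (fun i => c i) (m * τ k)
  have hcov : ∀ z ∈ Z, ∃ q : Σ k, F k, z ∈ bowenBall T (q.1 + N) q.2 (2 * ε) := fun z hz => by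
    by_contra! hno
    refine absurd (hZ z hz) (not_le.2 ?_)
    calc ∑' i, (bowenBall T (p i).2 (p i).1 ε).indicator (fun _ => c i) z
        ≤ ∑' k, m * τ k := by
          rw [hsum]
          refine ENNReal.tsum_le_tsum fun k => ?_
          simp only [hφ k]
          by_contra! hlt
          obtain ⟨y, hy, hzy⟩ := hFcov k z hz hlt
          exact hno ⟨k, y, hy⟩ hzy
      _ = m * ∑' k, τ k := ENNReal.tsum_mul_left
      _ < m * 1 := (ENNReal.mul_lt_mul_iff_right hm0 hm).2 hτ
      _ = m := mul_one m
  calc m * bowenMeasN T f Z s' (2 * ε) N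
      ≤ m * ∑' q : Σ k, F k, weight T f s' (q.2, q.1 + N) := mul_le_mul_right
        (bowenMeasN_le T f (fun q : Σ k, F k => ((q.2 : X 0), q.1 + N))
          (fun q => Nat.le_add_left N q.1) hcov) _
    _ = ∑' k, m * ∑' y : F k, weight T f s' (y, k + N) := by
        rw [ENNReal.tsum_sigma', ENNReal.tsum_mul_left]
    _ ≤ ∑' k, m * τ k * ∑' y : F k, weight T f (s + γ) (y, k + N) :=
        ENNReal.tsum_le_tsum fun k => by
          rw [mul_assoc, ← ENNReal.tsum_mul_left (a := τ k)]
          exact mul_le_mul_right (ENNReal.tsum_le_tsum fun y : F k => hs k y) _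
    _ ≤ ∑' k, ∑' i : {i // φ i = k}, c i * weight T f s (p i) :=
        ENNReal.tsum_le_tsum fun k => (hFsum k).trans_eq <| tsum_congr fun i =>
          congrArg (fun q => c i * weight T f s q) (Prod.ext rfl (hφ k i).symm)
    _ = ∑' i, c i * weight T f s (p i) := (hsum fun i => c i * weight T f s (p i)).symm

/-- In a cover of `Z ×ˢ W`, the balls whose first factor contains a given `z ∈ Z` have second
factors that cover `W`. So the `g`-weights of the second factors turn the first factors into a
weighted cover of `Z`. -/
theorem mul_bowenMeasN_le_prod {Z : Set (X 0)} {W : Set (Y 0)} {s s' t γ ε : ℝ} (hε : 0 < ε)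
    (hγ : ∀ (k : ℕ) (x' x'' : X k), dist x' x'' < ε → |f k x' - f k x''| < γ) {N : ℕ}
    {m : ℝ≥0∞} (hm0 : m ≠ 0) (hm : m ≠ ⊤) (hW : m ≤ bowenMeasN R g W t ε N)
    {τ : ℕ → ℝ≥0∞} (hτ : ∑' k, τ k < 1)
    (hs : ∀ k y, weight T f s' (y, k + N) ≤ τ k * weight T f (s + γ) (y, k + N)) :
    m * bowenMeasN T f Z s' (2 * ε) N ≤ bowenMeasN (X := fun k => X k × Y k)
      (prodSystem T R) (prodPotential f g) (Z ×ˢ W) (s + t) ε N := by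
  refine le_iInf₂ fun C hC => ?_
  let c : C → ℝ≥0∞ := fun q => weight R g t (q.1.1.2, q.1.2)
  refine (mul_bowenMeasN_le_tsum T f hε hγ (fun q : C => (q.1.1.1, q.1.2)) (fun q => hC.2.1 q q.2)
    c hm0 hm (fun z hz => hW.trans ?_) hτ hs).trans_eq ?_
  · refine (bowenMeasN_le R g (fun q : {q : C | z ∈ bowenBall T q.1.2 q.1.1.1 ε} =>
      (q.1.1.1.2, q.1.1.2)) (fun q => hC.2.1 q.1 q.1.2) fun w hw => ?_).trans_eq ?_
    · obtain ⟨q, hq, hzw⟩ := Set.mem_iUnion₂.1 (hC.2.2 (Set.mk_mem_prod hz hw))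
      obtain ⟨h1, h2⟩ := (mem_bowenBall_prod T R hε).1 hzw
      exact ⟨⟨⟨q, hq⟩, h1⟩, h2⟩
    · rw [tsum_subtype {q : C | z ∈ bowenBall T q.1.2 q.1.1.1 ε} c]
      exact tsum_congr fun q => rfl
  · exact tsum_congr fun q => by rw [mul_comm]; exact (weight_prod T R f g s t q.1.1 q.1.2).symm

theorem exists_bowenMeas_ne_zero {Z : Set (X 0)} {s : ℝ} (h : (s : EReal) < bowenPressure T f Z) :
    ∃ ε > 0, bowenMeas T f Z ε s ≠ 0 := by
  obtain ⟨ε, h⟩ := lt_iSup_iff.1 h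
  obtain ⟨hε, h⟩ := lt_iSup_iff.1 h
  exact ⟨ε, hε, fun h0 => absurd h (not_lt.2
    (iInf₂_le (f := fun (s : ℝ) (_ : bowenMeas T f Z ε s = 0) => (s : EReal)) s h0))⟩

/-- The parameter shift `2 * η` consists of `η` for the distortion of the Birkhoff sums and `η` for
the geometric fractions `exp (-η) ^ n`. -/
theorem bowenMeas_prod_ne_zero {Z : Set (X 0)} {W : Set (Y 0)} {a b η ε : ℝ} (hε : 0 < ε)
    (hη : 0 < η)
    (hf : ∀ (k : ℕ) (x' x'' : X k), dist x' x'' < ε → |f k x' - f k x''| < η)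
    (hZ : bowenMeas T f Z (2 * ε) a ≠ 0) (hW : bowenMeas R g W ε b ≠ 0) :
    bowenMeas (X := fun k => X k × Y k) (prodSystem T R) (prodPotential f g) (Z ×ˢ W) ε
      (a - 2 * η + b) ≠ 0 := by
  let r : ℕ → ℝ≥0∞ := fun n => ENNReal.ofReal (Real.exp (-η)) ^ n
  have hr : ∑' n, r n ≠ ⊤ := by
    have h1 : ENNReal.ofReal (Real.exp (-η)) < 1 :=
      ENNReal.ofReal_lt_one.2 (Real.exp_lt_one_iff.2 (by linarith))
    rw [ENNReal.tsum_geometric]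
    exact ENNReal.inv_ne_top.2 (tsub_pos_of_lt h1).ne'
  obtain ⟨N, ⟨hNZ, hNW⟩, hNr⟩ :=
    ((((tendsto_bowenMeasN T f Z a (2 * ε)).eventually (lt_mem_nhds (pos_iff_ne_zero.2 hZ))).and
      ((tendsto_bowenMeasN R g W b ε).eventually (lt_mem_nhds (pos_iff_ne_zero.2 hW)))).and
      ((ENNReal.tendsto_sum_nat_add r hr).eventually (gt_mem_nhds zero_lt_one))).exists
  -- The minimum with `1` keeps the lower bound for the premeasure of `W` finite.
  have hm0 : min (bowenMeasN R g W b ε N) 1 ≠ 0 := (lt_min hNW zero_lt_one).ne'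
  have key := mul_bowenMeasN_le_prod T R f g (Z := Z) (s := a - 2 * η) (s' := a) hε hf hm0
    ((min_le_right _ _).trans_lt ENNReal.one_lt_top).ne (min_le_left _ _) hNr fun k y => by
      refine (weight_le T f (s := a - 2 * η + η) (by linarith) le_rfl).trans_eq ?_
      rw [ENNReal.ofReal_pow (Real.exp_pos _).le, show a - (a - 2 * η + η) = η by ring]
  refine (lt_of_lt_of_le ?_ (key.trans (le_iSup (bowenMeasN _ _ _ _ _) N))).ne'
  exact pos_iff_ne_zero.2 (mul_ne_zero hm0 hNZ.ne')

theorem add_le_bowenPressure_prod (hf : EquicontinuousPotential f) (Z : Set (X 0))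
    (W : Set (Y 0)) :
    bowenPressure T f Z + bowenPressure R g W ≤
      bowenPressure (X := fun k => X k × Y k) (prodSystem T R) (prodPotential f g) (Z ×ˢ W) := by
  refine EReal.add_le_of_forall_lt fun a ha b hb => ?_
  induction a with
  | top => simp at ha
  | bot => simp
  | coe a =>
    induction b with
    | top => simp at hb
    | bot => simp
    | coe b =>
      obtain ⟨ε₁, hε₁, hZ⟩ := exists_bowenMeas_ne_zero T f ha
      obtain ⟨ε₂, hε₂, hW⟩ := exists_bowenMeas_ne_zero R g hb
      rw [← EReal.coe_add]
      refine EReal.ge_of_forall_gt_iff_ge.1 fun c hc => ?_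
      have hc : c < a + b := by exact_mod_cast hc
      -- With this `η` the exponent `a - 2 * η + b` of the product lies above `c`.
      obtain ⟨η, hη, hηc⟩ : ∃ η > 0, c < a - 2 * η + b :=
        ⟨(a + b - c) / 4, by linarith, by linarith⟩
      obtain ⟨δ, hδ, hfδ⟩ := hf η hη
      obtain ⟨ε, hε, hε'⟩ : ∃ ε > 0, 2 * ε ≤ ε₁ ∧ ε ≤ ε₂ ∧ ε ≤ δ :=
        ⟨min (ε₁ / 2) (min ε₂ δ), by positivity,
          by linarith [min_le_left (ε₁ / 2) (min ε₂ δ)],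
          (min_le_right _ _).trans (min_le_left _ _), (min_le_right _ _).trans (min_le_right _ _)⟩
      have hne := bowenMeas_prod_ne_zero T R f g (Z := Z) (W := W) (a := a) (b := b) hε hη
        (fun k x' x'' h => hfδ k x' x'' (h.trans_le hε'.2.2))
        ((pos_iff_ne_zero.2 hZ).trans_le (bowenMeas_anti_radius T f Z a hε'.1)).ne'
        ((pos_iff_ne_zero.2 hW).trans_le (bowenMeas_anti_radius R g W b hε'.2.1)).ne'
      refine le_trans (le_iInf₂ fun s hs => ?_) (le_iSup₂ (f := fun (ε : ℝ) (_ : 0 < ε) =>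
        bowenPressureAt (X := fun k => X k × Y k) (prodSystem T R) (prodPotential f g)
          (Z ×ˢ W) ε) ε hε)
      by_contra! hsc
      have hsc : s < c := by exact_mod_cast hsc
      exact hne (bowenMeas_eq_zero _ _ _ (hsc.trans hηc) (by simp [hs]))

end NDS

theorem theorem6p1 {X : ℕ → Type*} {Y : ℕ → Type*}
    [∀ k, MetricSpace (X k)] [∀ k, CompactSpace (X k)]
    [∀ k, MetricSpace (Y k)] [∀ k, CompactSpace (Y k)]
    (T : ∀ k, C(X k, X (k + 1))) (R : ∀ k, C(Y k, Y (k + 1)))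
    (f : ∀ k, C(X k, ℝ)) (g : ∀ k, C(Y k, ℝ))
    (hf : NDS.EquicontinuousPotential f) (hg : NDS.EquicontinuousPotential g)
    (Z : Set (X 0)) (W : Set (Y 0)) :
    (NDS.SumDefined (NDS.bowenPressure T f Z) (NDS.bowenPressure R g W) →
      NDS.bowenPressure T f Z + NDS.bowenPressure R g W ≤
        NDS.bowenPressure (X := fun k => X k × Y k)
          (NDS.prodSystem T R) (NDS.prodPotential f g) (Z ×ˢ W)) ∧
    (NDS.SumDefined (NDS.bowenPressure T f Z) (NDS.packPressure R g W) →
      NDS.bowenPressure (X := fun k => X k × Y k)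
          (NDS.prodSystem T R) (NDS.prodPotential f g) (Z ×ˢ W) ≤
        NDS.bowenPressure T f Z + NDS.packPressure R g W) :=
  ⟨fun _ => NDS.add_le_bowenPressure_prod T R f g hf Z W,
    NDS.bowenPressure_prod_le T R f g Z W⟩
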